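/- Theorem 2.7. Let $X$ be a Hausdorff space that is zero-dimensional, meaning that the clopen sets form a base for its topology. Let $C_c(X)$ be the ring of continuous functions $X\to\mathbb{R}$ with countable range, let $C_c^*(X)$ be its subring of bounded functions, and let $A_c(X)$ be any ring with $C_c^*(X)\subseteq A_c(X)\subseteq C_c(X)$. Let $\mathrm{Max}(A_c(X))$ be the set of maximal ideals of $A_c(X)$ with the hull-kernel topology, and let $\Psi_A : X\to \mathrm{Max}(A_c(X))$ be the map $x\mapsto M_{A,x}=\{f\in A_c(X): f(x)=0\}$. A Hausdorff compactification of $X$ is a pair $(\alpha,\alpha X)$ with $\alpha X$ compact Hausdorff and $\alpha : X\to\alpha X$ a topological embedding with dense image; $(\alpha,\alpha X)$ and $(\gamma,\gamma X)$ are topologically equivalent if there is a homeomorphism $t:\alpha X\to\gamma X$ with $t\circ\alpha=\gamma$. Then: 1. $\mathrm{Max}(A_c(X))$ is a compact Hausdorff zero-dimensional space, and $(\Psi_A,\mathrm{Max}(A_c(X)))$ is a Hausdorff compactification of $X$. 2. $(\Psi_A,\mathrm{Max}(A_c(X)))$ is topologically equivalent to the Banaschewski compactification $\beta_0X$, the largest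 zero-dimensional Hausdorff compactification of $X$ (where $(\alpha,\alpha X)$ is larger than $(\gamma,\gamma X)$ if there is a continuous $t:\alpha X\to\gamma X$ with $t\circ\alpha=\gamma$). 3. If moreover $X$ is strongly zero-dimensional, meaning that its Stone–Čech compactification $\beta X$ is zero-dimensional, then $(\Psi_A,\mathrm{Max}(A_c(X)))$ is topologically equivalent to $\beta X$. -/

import Mathlib

open Set Topology

universe u v w

/-- A space is zero-dimensional if its clopen sets form a base for its topology. -/
def IsZeroDimensional (X : Type u) [TopologicalSpace X] : Prop :=
  TopologicalSpace.IsTopologicalBasis {s : Set X | IsClopen s}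

section Rings

variable (X : Type u) [TopologicalSpace X]

/-- The ring `C_c(X)` of continuous real functions on `X` with countable range. -/
def countableRangeRing : Subring C(X, ℝ) where
  carrier := {f | (range f).Countable}
  mul_mem' := by
    intro f g hf hg
    refine (Set.Countable.image2 hf hg (· * ·)).mono ?_
    rintro _ ⟨x, rfl⟩
    exact ⟨f x, ⟨x, rfl⟩, g x, ⟨x, rfl⟩, rfl⟩
  one_mem' := (countable_singleton (1 : ℝ)).mono (by rintro _ ⟨x, rfl⟩; rfl)
  add_mem' := by
    intro f g hf hg
    refine (Set.Countable.image2 hf hg (· + ·)).mono ?_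
    rintro _ ⟨x, rfl⟩
    exact ⟨f x, ⟨x, rfl⟩, g x, ⟨x, rfl⟩, rfl⟩
  zero_mem' := (countable_singleton (0 : ℝ)).mono (by rintro _ ⟨x, rfl⟩; rfl)
  neg_mem' := by
    intro f hf
    refine (hf.image (fun t => -t)).mono ?_
    rintro _ ⟨x, rfl⟩
    exact ⟨f x, ⟨x, rfl⟩, rfl⟩

/-- The ring `C^*(X)` of bounded continuous real functions on `X`. -/
def boundedRing : Subring C(X, ℝ) where
  carrier := {f | ∃ B : ℝ, ∀ x, |f x| ≤ B}
  mul_mem' := by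
    rintro f g ⟨B, hB⟩ ⟨C, hC⟩
    refine ⟨B * C, fun x => ?_⟩
    rw [ContinuousMap.mul_apply, abs_mul]
    exact mul_le_mul (hB x) (hC x) (abs_nonneg _) ((abs_nonneg _).trans (hB x))
  one_mem' := ⟨1, fun x => by simp⟩
  add_mem' := by
    rintro f g ⟨B, hB⟩ ⟨C, hC⟩
    exact ⟨B + C, fun x => (abs_add_le _ _).trans (add_le_add (hB x) (hC x))⟩
  zero_mem' := ⟨0, fun x => by simp⟩
  neg_mem' := by
    rintro f ⟨B, hB⟩
    exact ⟨B, fun x => by simpa using hB x⟩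

/-- The ring `C_c^*(X) = C_c(X) ∩ C^*(X)`. -/
def boundedCountableRangeRing : Subring C(X, ℝ) :=
  countableRangeRing X ⊓ boundedRing X

variable {X}

/-- Evaluation at `x`, as a ring homomorphism `A → ℝ`. -/
def evalAt (A : Subring C(X, ℝ)) (x : X) : A →+* ℝ where
  toFun f := (f : C(X, ℝ)) x
  map_one' := rfl
  map_mul' _ _ := rfl
  map_zero' := rfl
  map_add' _ _ := rfl

/-- The ideal `M_{A,x} = {f ∈ A : f(x) = 0}`. -/
def fixedIdeal (A : Subring C(X, ℝ)) (x : X) : Ideal A :=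
  RingHom.ker (evalAt A x)

theorem mem_fixedIdeal {A : Subring C(X, ℝ)} {x : X} {f : A} :
    f ∈ fixedIdeal A x ↔ (f : C(X, ℝ)) x = 0 :=
  Iff.rfl

theorem fixedIdeal_isMaximal {A : Subring C(X, ℝ)} (hA : boundedCountableRangeRing X ≤ A)
    (x : X) : (fixedIdeal A x).IsMaximal := by
  refine RingHom.ker_isMaximal_of_surjective (evalAt A x) fun r => ?_
  have hr : ContinuousMap.const X r ∈ boundedCountableRangeRing X :=
    ⟨(countable_singleton r).mono (by rintro _ ⟨y, rfl⟩; rfl), |r|, fun _ => le_rfl⟩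
  exact ⟨⟨_, hA hr⟩, rfl⟩

/-- The map `Ψ_A : X → Max(A)`, `x ↦ M_{A,x}`. Here `MaximalSpectrum A` is the set of maximal
ideals of `A`; its Mathlib topology is the hull-kernel topology. -/
def structureMap (A : Subring C(X, ℝ)) (hA : boundedCountableRangeRing X ≤ A) (x : X) :
    MaximalSpectrum A :=
  ⟨fixedIdeal A x, fixedIdeal_isMaximal hA x⟩

end Rings

section Compactifications

variable {X : Type u} [TopologicalSpace X]

/-- `(α, K)` is a Hausdorff compactification of `X`: `K` is compact Hausdorff and `α : X → K` is a
topological embedding with dense range. -/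
structure IsHausdorffCompactification {K : Type v} [TopologicalSpace K] (α : X → K) : Prop where
  compactSpace : CompactSpace K
  t2Space : T2Space K
  isEmbedding : IsEmbedding α
  denseRange : DenseRange α

/-- `(α, K) ≧ (γ, L)`: there is a continuous `t : K → L` with `t ∘ α = γ`. -/
def CompactificationGE {K : Type v} {L : Type w} [TopologicalSpace K] [TopologicalSpace L]
    (α : X → K) (γ : X → L) : Prop :=
  ∃ t : K → L, Continuous t ∧ t ∘ α = γ

/-- `(α, K) ≈ (γ, L)`: there is a homeomorphism `t : K → L` with `t ∘ α = γ`. -/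
def TopologicallyEquivalent {K : Type v} {L : Type w} [TopologicalSpace K] [TopologicalSpace L]
    (α : X → K) (γ : X → L) : Prop :=
  ∃ t : K ≃ₜ L, t ∘ α = γ

variable (X) in
/-- The canonical map `x ↦ (g(x))_g` of `X` into the product of copies of the discrete space
`{0,1}` indexed by all continuous `g : X → {0,1}`. -/
def boolEval (x : X) : C(X, Bool) → Bool := fun g => g x

variable (X) in
/-- The Banaschewski compactification `β₀X`, realized as the closure of the canonical image of `X`
in the product of copies of `{0,1}` indexed by all continuous `g : X → {0,1}`. That it is the
largest zero-dimensional Hausdorff compactification is `banaschewski_isLargest` below. -/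
def Banaschewski : Type u := closure (range (boolEval X))

instance : TopologicalSpace (Banaschewski X) :=
  inferInstanceAs (TopologicalSpace (closure (range (boolEval X))))

variable (X) in
/-- The canonical map `X → β₀X`. -/
def banaschewskiUnit (x : X) : Banaschewski X :=
  ⟨boolEval X x, subset_closure (mem_range_self x)⟩

instance : CompactSpace (Banaschewski X) :=
  isCompact_iff_compactSpace.mp isClosed_closure.isCompact

instance : T2Space (Banaschewski X) :=
  inferInstanceAs (T2Space (closure (range (boolEval X))))

instance : TotallyDisconnectedSpace (Banaschewski X) :=
  inferInstanceAs (TotallyDisconnectedSpace (closure (range (boolEval X))))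

theorem continuous_boolEval : Continuous (boolEval X) :=
  continuous_pi fun g => g.continuous

theorem isEmbedding_boolEval [T2Space X] (hX : IsZeroDimensional X) :
    IsEmbedding (boolEval X) := by
  classical
  have key : ∀ U : Set X, IsClopen U → ∃ g : C(X, Bool), ∀ y, g y = true ↔ y ∈ U :=
    fun U hU => ⟨⟨fun y => decide (y ∈ U), (IsLocallyConstant.iff_continuous _).mp <| by
      rw [IsLocallyConstant.iff_exists_open]
      intro y
      by_cases hy : y ∈ U
      · exact ⟨U, hU.isOpen, hy, fun z hz => by simp [hy, hz]⟩
      · exact ⟨Uᶜ, hU.compl.isOpen, hy, fun z hz => by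
          have hz' : z ∉ U := hz
          simp [hy, hz']⟩⟩, fun y => by simp⟩
  refine ⟨⟨le_antisymm continuous_boolEval.le_induced ?_⟩, ?_⟩
  · refine le_of_le_of_eq (le_generateFrom fun U hU => ?_) hX.eq_generateFrom.symm
    obtain ⟨g, hg⟩ := key U hU
    refine isOpen_induced_iff.mpr ⟨{p : C(X, Bool) → Bool | p g = true}, ?_, ?_⟩
    · have hc : Continuous fun p : C(X, Bool) → Bool => p g := continuous_apply g
      exact (isOpen_discrete ({true} : Set Bool)).preimage hc
    · ext y
      exact hg y
  · intro x y hxy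
    by_contra hne
    obtain ⟨U, hU, hxU, hUy⟩ :=
      hX.exists_subset_of_mem_open (show x ∈ ({y}ᶜ : Set X) from hne) isOpen_compl_singleton
    obtain ⟨g, hg⟩ := key U hU
    have h1 : g x = g y := congrFun hxy g
    exact hUy ((hg y).mp (h1 ▸ (hg x).mpr hxU)) rfl

theorem isHausdorffCompactification_banaschewskiUnit [T2Space X] (hX : IsZeroDimensional X) :
    IsHausdorffCompactification (banaschewskiUnit X) where
  compactSpace := inferInstance
  t2Space := inferInstance
  isEmbedding := (isEmbedding_boolEval hX).codRestrict _ _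
  denseRange := by
    intro p
    refine closure_subtype.mpr ?_
    have h : range (boolEval X) ⊆ Subtype.val '' range (banaschewskiUnit X) := by
      rintro _ ⟨x, rfl⟩
      exact ⟨banaschewskiUnit X x, mem_range_self x, rfl⟩
    exact closure_mono h p.2

/-- `β₀X` is the largest zero-dimensional Hausdorff compactification of `X`. -/
theorem banaschewski_isLargest [T2Space X] (hX : IsZeroDimensional X) :
    IsHausdorffCompactification (banaschewskiUnit X) ∧ IsZeroDimensional (Banaschewski X) ∧
      ∀ (L : Type v) [TopologicalSpace L] (γ : X → L), IsHausdorffCompactification γ →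
        IsZeroDimensional L → CompactificationGE (banaschewskiUnit X) γ := by
  refine ⟨isHausdorffCompactification_banaschewskiUnit hX,
    loc_compact_Haus_tot_disc_of_zero_dim, fun L _ γ hγ hL => ?_⟩
  have := hγ.compactSpace
  have := hγ.t2Space
  let c : C(X, L) := ⟨γ, hγ.isEmbedding.continuous⟩
  let φ : (C(X, Bool) → Bool) → (C(L, Bool) → Bool) := fun p g => p (g.comp c)
  have hφ : Continuous φ := continuous_pi fun g => continuous_apply _
  have hcl : IsClosed (range (boolEval L)) := (isCompact_range continuous_boolEval).isClosed
  have hmem : ∀ p : Banaschewski X, φ p.1 ∈ range (boolEval L) := fun p => by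
    have h : closure (range (boolEval X)) ⊆ φ ⁻¹' range (boolEval L) := by
      refine closure_minimal ?_ (hcl.preimage hφ)
      rintro _ ⟨x, rfl⟩
      exact ⟨γ x, rfl⟩
    exact h p.2
  choose t ht using hmem
  refine ⟨t, ?_, ?_⟩
  · rw [(isEmbedding_boolEval hL).continuous_iff]
    have : boolEval L ∘ t = fun p : Banaschewski X => φ p.1 := funext ht
    rw [this]
    exact hφ.comp continuous_subtype_val
  · funext x
    exact (isEmbedding_boolEval hL).injective (ht (banaschewskiUnit X x))

end Compactifications

/-! Indicators of clopen sets are idempotents of `A`, and they separate its maximal ideals. If `M ≠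
N`, write `f + g = 1` with `f ∈ M`, `g ∈ N`. A countable range misses some `r` in `(0, 1)`, so `U =
{f > r}` is clopen; `f` is at least `r` on `U` and `g` at least `1 - r` off it. Dividing there puts
the indicator of `U` in `M` and that of its complement in `N`. So `Max(A)`, always compact, is
totally separated, hence zero-dimensional.

Recording which indicators avoid `M` maps `Max(A)` to `β₀X`, while maximality of `β₀X` gives a map
back. Both fix the dense copy of `X`, so they are mutually inverse. If `βX` is zero-dimensional,
`β₀X` dominates it too, and `βX` dominates every compactification. -/

section ClopenIndicators

variable {X : Type u} [TopologicalSpace X]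

/-- The characteristic function of a clopen set. -/
noncomputable def clopenIndicator {U : Set X} (hU : IsClopen U) : C(X, ℝ) :=
  ⟨U.indicator 1, hU.continuous_indicator continuous_one⟩

theorem clopenIndicator_of_mem {U : Set X} (hU : IsClopen U) {x : X} (hx : x ∈ U) :
    clopenIndicator hU x = 1 :=
  indicator_of_mem hx 1

theorem clopenIndicator_of_notMem {U : Set X} (hU : IsClopen U) {x : X} (hx : x ∉ U) :
    clopenIndicator hU x = 0 :=
  indicator_of_notMem hx 1

theorem clopenIndicator_mem {U : Set X} (hU : IsClopen U) :
    clopenIndicator hU ∈ boundedCountableRangeRing X := by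
  refine ⟨((countable_singleton (1 : ℝ)).insert 0).mono ?_, 1, fun x => ?_⟩
  · rintro _ ⟨x, rfl⟩
    by_cases hx : x ∈ U
    · exact Or.inr (clopenIndicator_of_mem hU hx)
    · exact Or.inl (clopenIndicator_of_notMem hU hx)
  · by_cases hx : x ∈ U
    · simp [clopenIndicator_of_mem hU hx]
    · simp [clopenIndicator_of_notMem hU hx]

theorem clopenIndicator_add_compl {U : Set X} (hU : IsClopen U) :
    clopenIndicator hU + clopenIndicator hU.compl = 1 := by
  ext x
  by_cases hx : x ∈ U
  · have hx' : x ∉ Uᶜ := fun h => h hx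
    simp [clopenIndicator_of_mem hU hx, clopenIndicator_of_notMem hU.compl hx']
  · have hx' : x ∈ Uᶜ := hx
    simp [clopenIndicator_of_notMem hU hx, clopenIndicator_of_mem hU.compl hx']

theorem clopenIndicator_mul_compl {U : Set X} (hU : IsClopen U) :
    clopenIndicator hU * clopenIndicator hU.compl = 0 := by
  ext x
  by_cases hx : x ∈ U
  · have hx' : x ∉ Uᶜ := fun h => h hx
    simp [clopenIndicator_of_notMem hU.compl hx']
  · simp [clopenIndicator_of_notMem hU hx]

/-- A function of countable range that exceeds a positive constant on a clopen set is invertible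
on that set within `C_c^*(X)`. -/
theorem exists_mul_eq_clopenIndicator {f : C(X, ℝ)} (hf : f ∈ countableRangeRing X) {U : Set X}
    (hU : IsClopen U) {c : ℝ} (hc : 0 < c) (hfU : ∀ x ∈ U, c ≤ f x) :
    ∃ h ∈ boundedCountableRangeRing X, h * f = clopenIndicator hU := by
  have hpos : ∀ x, 0 < max c (f x) := fun x => lt_max_of_lt_left hc
  -- Truncating at `c` leaves `f` unchanged on `U` and makes the reciprocal global and bounded by
  -- `c⁻¹`.
  let k : C(X, ℝ) := ⟨fun x => (max c (f x))⁻¹,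
    (continuous_const.max f.continuous).inv₀ fun x => (hpos x).ne'⟩
  have hk : k ∈ boundedCountableRangeRing X := by
    refine ⟨(Set.Countable.image hf fun t => (max c t)⁻¹).mono ?_, c⁻¹, fun x => ?_⟩
    · rintro _ ⟨x, rfl⟩
      exact ⟨f x, ⟨x, rfl⟩, rfl⟩
    · change |(max c (f x))⁻¹| ≤ c⁻¹
      rw [abs_of_pos (inv_pos.mpr (hpos x))]
      exact inv_anti₀ hc (le_max_left _ _)
  refine ⟨clopenIndicator hU * k, mul_mem (clopenIndicator_mem hU) hk, ?_⟩
  ext x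
  by_cases hx : x ∈ U
  · have hfx : max c (f x) = f x := max_eq_right (hfU x hx)
    have hne : f x ≠ 0 := (hc.trans_le (hfU x hx)).ne'
    change clopenIndicator hU x * (max c (f x))⁻¹ * f x = clopenIndicator hU x
    rw [clopenIndicator_of_mem hU hx, hfx, one_mul, inv_mul_cancel₀ hne]
  · simp [clopenIndicator_of_notMem hU hx]

/-- A function of countable range can be cut at some level in any open interval. -/
theorem exists_isClopen_superlevel {f : C(X, ℝ)} (hf : f ∈ countableRangeRing X) {a b : ℝ}
    (hab : a < b) :
    ∃ r ∈ Ioo a b, IsClopen {x | r < f x} := by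
  -- At an omitted level the strict and weak superlevel sets coincide.
  obtain ⟨r, hr, hrf⟩ : (Ioo a b \ range f).Nonempty := by
    by_contra h
    have hsub : Ioo a b ⊆ range f := sdiff_eq_empty.mp (not_nonempty_iff_eq_empty.mp h)
    exact hab.not_ge (Cardinal.Real.Ioo_countable_iff.mp (Set.Countable.mono hsub hf))
  have hne : ∀ x, f x ≠ r := fun x hx => hrf ⟨x, hx⟩
  refine ⟨r, hr, ⟨?_, isOpen_lt continuous_const f.continuous⟩⟩
  have : {x | r < f x} = {x | r ≤ f x} := by
    ext x
    exact ⟨fun h : r < f x => h.le, fun h => lt_of_le_of_ne h (hne x).symm⟩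
  rw [this]
  exact isClosed_le continuous_const f.continuous

theorem isClopen_setOf_eq_true (g : C(X, Bool)) : IsClopen {x | g x = true} :=
  (isClopen_discrete ({true} : Set Bool)).preimage g.continuous

end ClopenIndicators

/-! ### Hull-kernel topology of a commutative ring -/

namespace MaximalSpectrum

variable {R : Type u} [CommRing R]

theorem isOpen_setOf_notMem (f : R) : IsOpen {M : MaximalSpectrum R | f ∉ M.asIdeal} :=
  (PrimeSpectrum.basicOpen f).isOpen.preimage toPrimeSpectrum_continuous

theorem isTopologicalBasis_setOf_notMem :
    TopologicalSpace.IsTopologicalBasis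
      (range fun f : R => {M : MaximalSpectrum R | f ∉ M.asIdeal}) := by
  convert PrimeSpectrum.isTopologicalBasis_basic_opens.isInducing
    (⟨rfl⟩ : IsInducing (toPrimeSpectrum (R := R))) using 1
  rw [← range_comp]
  rfl

/-- Complementary idempotents cut out clopen sets of maximal ideals. -/
theorem isClopen_setOf_notMem {e e' : R} (hadd : e + e' = 1) (hmul : e * e' = 0) :
    IsClopen {M : MaximalSpectrum R | e ∉ M.asIdeal} := by
  refine ⟨⟨?_⟩, isOpen_setOf_notMem e⟩
  convert isOpen_setOf_notMem e' using 1
  ext M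
  simp only [mem_compl_iff, mem_ofPred_eq, not_not]
  constructor
  · intro he he'
    exact M.isMaximal.ne_top ((Ideal.eq_top_iff_one _).mpr (hadd ▸ add_mem he he'))
  · intro he'
    exact (M.isMaximal.isPrime.mem_or_mem (hmul ▸ zero_mem _ : e * e' ∈ M.asIdeal)).resolve_right he'

/-- Every prime specializes to a maximal ideal, so opens of the prime spectrum covering the maximal
points cover all of it. -/
instance compactSpace : CompactSpace (MaximalSpectrum R) := by
  have hind : IsInducing (toPrimeSpectrum (R := R)) := ⟨rfl⟩
  rw [← isCompact_univ_iff, hind.isCompact_iff, image_univ]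
  refine isCompact_of_finite_subcover fun {ι} U hU hcov => ?_
  obtain ⟨t, ht⟩ := isCompact_univ.elim_finite_subcover U hU fun p _ => by
    obtain ⟨m, hm, hpm⟩ := Ideal.exists_le_maximal p.asIdeal p.isPrime.ne_top
    let M : MaximalSpectrum R := ⟨m, hm⟩
    obtain ⟨i, hi⟩ := mem_iUnion.mp (hcov ⟨M, rfl⟩)
    have hs : p ⤳ M.toPrimeSpectrum := (PrimeSpectrum.le_iff_specializes _ _).mp hpm
    exact mem_iUnion.mpr ⟨i, hs.mem_open (hU i) hi⟩
  exact ⟨t, (subset_univ _).trans ht⟩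

end MaximalSpectrum

/-! ### The maximal ideal space of an intermediate ring -/

section StructureSpace

variable {X : Type u} [TopologicalSpace X] {A : Subring C(X, ℝ)}

/-- The characteristic function of a clopen set, as an element of an intermediate ring. -/
noncomputable def ringIndicator (hA : boundedCountableRangeRing X ≤ A) {U : Set X}
    (hU : IsClopen U) : A :=
  ⟨clopenIndicator hU, hA (clopenIndicator_mem hU)⟩

theorem isClopen_setOf_ringIndicator_notMem (hA : boundedCountableRangeRing X ≤ A) {U : Set X}
    (hU : IsClopen U) :
    IsClopen {M : MaximalSpectrum A | ringIndicator hA hU ∉ M.asIdeal} :=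
  MaximalSpectrum.isClopen_setOf_notMem (e' := ringIndicator hA hU.compl)
    (Subtype.ext (clopenIndicator_add_compl hU)) (Subtype.ext (clopenIndicator_mul_compl hU))

theorem ringIndicator_notMem_structureMap (hA : boundedCountableRangeRing X ≤ A) {U : Set X}
    (hU : IsClopen U) (x : X) :
    ringIndicator hA hU ∉ (structureMap A hA x).asIdeal ↔ x ∈ U := by
  change ¬ clopenIndicator hU x = 0 ↔ x ∈ U
  by_cases hx : x ∈ U
  · simp [clopenIndicator_of_mem hU hx, hx]
  · simp [clopenIndicator_of_notMem hU hx, hx]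

/-- The partial inverse of `f` on `U` is bounded, so it lies in every intermediate ring `A`. -/
theorem ringIndicator_mem_of_le (hA : boundedCountableRangeRing X ≤ A)
    (hA' : A ≤ countableRangeRing X) {I : Ideal A} {f : A} (hf : f ∈ I) {U : Set X}
    (hU : IsClopen U) {c : ℝ} (hc : 0 < c) (hfU : ∀ x ∈ U, c ≤ (f : C(X, ℝ)) x) :
    ringIndicator hA hU ∈ I := by
  obtain ⟨h, hh, heq⟩ := exists_mul_eq_clopenIndicator (hA' f.2) hU hc hfU
  have : ringIndicator hA hU = ⟨h, hA hh⟩ * f := Subtype.ext heq.symm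
  rw [this]
  exact I.mul_mem_left _ hf

theorem exists_ringIndicator_separating (hA : boundedCountableRangeRing X ≤ A)
    (hA' : A ≤ countableRangeRing X) {M N : MaximalSpectrum A} (hMN : M ≠ N) :
    ∃ (U : Set X) (hU : IsClopen U),
      ringIndicator hA hU ∈ M.asIdeal ∧ ringIndicator hA hU ∉ N.asIdeal := by
  have hsup : M.asIdeal ⊔ N.asIdeal = ⊤ :=
    M.isMaximal.coprime_of_ne N.isMaximal fun h => hMN (MaximalSpectrum.ext h)
  obtain ⟨f, hf, g, hg, hfg⟩ :=
    Submodule.mem_sup.mp (hsup ▸ Submodule.mem_top : (1 : A) ∈ M.asIdeal ⊔ N.asIdeal)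
  obtain ⟨r, hr, hU⟩ := exists_isClopen_superlevel (hA' f.2) (zero_lt_one' ℝ)
  refine ⟨_, hU, ringIndicator_mem_of_le hA hA' hf hU hr.1 fun x hx => le_of_lt hx, fun hN => ?_⟩
  have hN' : ringIndicator hA hU.compl ∈ N.asIdeal := by
    refine ringIndicator_mem_of_le hA hA' hg hU.compl (sub_pos.mpr hr.2) fun x hx => ?_
    have h1 : (f : C(X, ℝ)) x + (g : C(X, ℝ)) x = 1 :=
      congrArg (fun k : A => (k : C(X, ℝ)) x) hfg
    have h2 : (f : C(X, ℝ)) x ≤ r := not_lt.mp hx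
    linarith
  have hone : ringIndicator hA hU + ringIndicator hA hU.compl = 1 :=
    Subtype.ext (clopenIndicator_add_compl hU)
  exact N.isMaximal.ne_top ((Ideal.eq_top_iff_one _).mpr (hone ▸ add_mem hN hN'))

theorem totallySeparatedSpace_maximalSpectrum (hA : boundedCountableRangeRing X ≤ A)
    (hA' : A ≤ countableRangeRing X) : TotallySeparatedSpace (MaximalSpectrum A) := by
  rw [totallySeparatedSpace_iff_exists_isClopen]
  intro M N hMN
  obtain ⟨U, hU, hM, hN⟩ := exists_ringIndicator_separating hA hA' hMN.symm
  exact ⟨_, isClopen_setOf_ringIndicator_notMem hA hU, hN, fun h => h hM⟩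

theorem continuous_structureMap (hA : boundedCountableRangeRing X ≤ A) :
    Continuous (structureMap A hA) := by
  rw [MaximalSpectrum.isTopologicalBasis_setOf_notMem.continuous_iff]
  rintro _ ⟨f, rfl⟩
  exact (isOpen_compl_singleton (x := (0 : ℝ))).preimage (f : C(X, ℝ)).continuous

theorem denseRange_structureMap (hA : boundedCountableRangeRing X ≤ A) :
    DenseRange (structureMap A hA) := by
  rw [DenseRange, MaximalSpectrum.isTopologicalBasis_setOf_notMem.dense_iff]
  rintro _ ⟨f, rfl⟩ ⟨M, hM⟩
  obtain ⟨x, hx⟩ : ∃ x, (f : C(X, ℝ)) x ≠ 0 := by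
    by_contra! h
    have hf : f = 0 := Subtype.ext (ContinuousMap.ext h)
    exact hM (hf ▸ zero_mem _)
  exact ⟨structureMap A hA x, hx, x, rfl⟩

theorem isEmbedding_structureMap [T2Space X] (hX : IsZeroDimensional X)
    (hA : boundedCountableRangeRing X ≤ A) : IsEmbedding (structureMap A hA) := by
  have hpre : ∀ {U : Set X} (hU : IsClopen U),
      structureMap A hA ⁻¹' {M | ringIndicator hA hU ∉ M.asIdeal} = U := fun hU =>
    Set.ext fun x => ringIndicator_notMem_structureMap hA hU x
  have hind : IsInducing (structureMap A hA) := by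
    refine ⟨le_antisymm (continuous_structureMap hA).le_induced ?_⟩
    refine le_of_le_of_eq (le_generateFrom fun U hU => ?_) hX.eq_generateFrom.symm
    exact isOpen_induced_iff.mpr
      ⟨_, (isClopen_setOf_ringIndicator_notMem hA hU).isOpen, hpre hU⟩
  -- Injectivity is automatic, since `X` is T0.
  exact hind.isEmbedding

theorem isHausdorffCompactification_structureMap [T2Space X] (hX : IsZeroDimensional X)
    (hA : boundedCountableRangeRing X ≤ A) (hA' : A ≤ countableRangeRing X) :
    IsHausdorffCompactification (structureMap A hA) where
  compactSpace := inferInstance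
  t2Space :=
    have := totallySeparatedSpace_maximalSpectrum hA hA'
    inferInstance
  isEmbedding := isEmbedding_structureMap hX hA
  denseRange := denseRange_structureMap hA

theorem IsZeroDimensional.of_totallySeparatedSpace {H : Type u} [TopologicalSpace H]
    [CompactSpace H] [TotallySeparatedSpace H] : IsZeroDimensional H :=
  loc_compact_Haus_tot_disc_of_zero_dim

theorem isZeroDimensional_maximalSpectrum (hA : boundedCountableRangeRing X ≤ A)
    (hA' : A ≤ countableRangeRing X) : IsZeroDimensional (MaximalSpectrum A) :=
  have := totallySeparatedSpace_maximalSpectrum hA hA'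
  IsZeroDimensional.of_totallySeparatedSpace

-- Each coordinate of the map tests one idempotent, a clopen condition on `M`; density of `X` keeps
-- the image in the closure defining `β₀X`.
open Classical in
theorem structureMap_ge_banaschewskiUnit (hA : boundedCountableRangeRing X ≤ A) :
    CompactificationGE (structureMap A hA) (banaschewskiUnit X) := by
  let φ : MaximalSpectrum A → C(X, Bool) → Bool := fun M g =>
    decide (ringIndicator hA (isClopen_setOf_eq_true g) ∉ M.asIdeal)
  have hφ : Continuous φ := continuous_pi fun g => by
    refine continuous_bool_rng true |>.mpr ?_
    convert isClopen_setOf_ringIndicator_notMem hA (isClopen_setOf_eq_true g) using 1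
    ext M
    simp [φ]
  have hφx : ∀ x, φ (structureMap A hA x) = boolEval X x := fun x => funext fun g => by
    rw [Bool.eq_iff_iff]
    exact decide_eq_true_iff.trans
      (ringIndicator_notMem_structureMap hA (isClopen_setOf_eq_true g) x)
  have hmem : ∀ M, φ M ∈ closure (range (boolEval X)) := fun M =>
    closure_mono (by rintro _ ⟨_, ⟨x, rfl⟩, rfl⟩; exact ⟨x, (hφx x).symm⟩)
      (image_closure_subset_closure_image hφ ⟨M, denseRange_structureMap hA M, rfl⟩)
  exact ⟨fun M => ⟨φ M, hmem M⟩, hφ.subtype_mk hmem, funext fun x => Subtype.ext (hφx x)⟩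

end StructureSpace

/-! ### Comparing compactifications -/

section Equivalence

variable {X : Type u} {K : Type v} {L : Type w} [TopologicalSpace K] [TopologicalSpace L]

theorem CompactificationGE.trans {Y : Type*} [TopologicalSpace Y] {α : X → K} {γ : X → L}
    {δ : X → Y} (h : CompactificationGE α γ) (h' : CompactificationGE γ δ) :
    CompactificationGE α δ := by
  obtain ⟨t, ht, rfl⟩ := h
  obtain ⟨s, hs, rfl⟩ := h'
  exact ⟨s ∘ t, hs.comp ht, rfl⟩

/-- Two dense maps into Hausdorff spaces, each of which factors through the other, are
equivalent. -/
theorem TopologicallyEquivalent.of_ge [T2Space K] [T2Space L] {α : X → K} {γ : X → L}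
    (hα : DenseRange α) (hγ : DenseRange γ) (h : CompactificationGE α γ)
    (h' : CompactificationGE γ α) : TopologicallyEquivalent α γ := by
  obtain ⟨t, ht, htα⟩ := h
  obtain ⟨s, hs, hsγ⟩ := h'
  have hst : s ∘ t = id := hα.equalizer (hs.comp ht) continuous_id <| by
    rw [Function.comp_assoc, htα, hsγ, Function.id_comp]
  have hts : t ∘ s = id := hγ.equalizer (ht.comp hs) continuous_id <| by
    rw [Function.comp_assoc, hsγ, htα, Function.id_comp]
  exact ⟨⟨⟨t, s, congrFun hst, congrFun hts⟩, ht, hs⟩, htα⟩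

theorem stoneCechUnit_ge [TopologicalSpace X] [CompactSpace K] [T2Space K] {α : X → K} (hα : Continuous α) :
    CompactificationGE (stoneCechUnit : X → StoneCech X) α :=
  ⟨stoneCechExtend hα, continuous_stoneCechExtend hα, stoneCechExtend_extends hα⟩

theorem isHausdorffCompactification_stoneCechUnit [TopologicalSpace X] [T2Space X] (hX : IsZeroDimensional X) :
    IsHausdorffCompactification (stoneCechUnit : X → StoneCech X) :=
  -- Complete regularity is what makes `X → βX` an embedding.
  have : CompletelyRegularSpace X := .of_isTopologicalBasis_clopens hX
  have : T35Space X := {}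
  { compactSpace := inferInstance
    t2Space := inferInstance
    isEmbedding := isEmbedding_stoneCechUnit
    denseRange := denseRange_stoneCechUnit }

end Equivalence

theorem theorem2p7 {X : Type u} [TopologicalSpace X] [T2Space X] (hX : IsZeroDimensional X)
    (A : Subring C(X, ℝ)) (hA : boundedCountableRangeRing X ≤ A) (hA' : A ≤ countableRangeRing X) :
    IsHausdorffCompactification (structureMap A hA) ∧
    IsZeroDimensional (MaximalSpectrum A) ∧
    TopologicallyEquivalent (structureMap A hA) (banaschewskiUnit X) ∧
    (IsZeroDimensional (StoneCech X) →
      TopologicallyEquivalent (structureMap A hA) (stoneCechUnit : X → StoneCech X)) := by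
  have hcomp := isHausdorffCompactification_structureMap hX hA hA'
  have := hcomp.t2Space
  have hzero := isZeroDimensional_maximalSpectrum hA hA'
  have hge := structureMap_ge_banaschewskiUnit hA
  obtain ⟨hban, -, hlargest⟩ := banaschewski_isLargest.{u, u} hX
  refine ⟨hcomp, hzero, .of_ge hcomp.denseRange hban.denseRange hge (hlargest _ _ hcomp hzero),
    fun hsc => ?_⟩
  have hst := isHausdorffCompactification_stoneCechUnit hX
  -- `Max(A)` dominates `β₀X`, which dominates the zero-dimensional `βX`.
  exact .of_ge hcomp.denseRange hst.denseRange (hge.trans (hlargest _ _ hst hsc))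
    (stoneCechUnit_ge hcomp.isEmbedding.continuous)
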